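/- Let $\mathcal{C}$ be a (locally small) category. A category is cofiltered if it is small and non-empty, any two objects $s,t$ admit an object $u$ with maps $u\to s$ and $u\to t$, and for any two parallel maps $f,g$ there is a map $h$ with $fh=gh$. Let $\mathrm{pro}\text{-}\mathcal{C}$ be the category whose objects (pro-objects) are all functors $X\colon I\to\mathcal{C}$, $s\mapsto X_s$, from cofiltered categories $I$, with $$\mathrm{Hom}_{\mathrm{pro}\text{-}\mathcal{C}}(X,Y)=\lim_s\operatorname{colim}_t\mathrm{Hom}_{\mathcal{C}}(X_t,Y_s)$$ and composition induced by that of $\mathcal{C}$. Let $c\colon\mathcal{C}\to\mathrm{pro}\text{-}\mathcal{C}$ be the functor that sends an object to the constant pro-object with that value, indexed by the category with one object and one map. Theorem 5.1. Let $C$ be any class of objects of $\mathcal{C}$, and let $cC$ be the image of $C$ under $c$. Let $\overline{cC}$ be the closure of $cC$ under isomorphisms and cofiltered limits, that is, the smallest class of objects of $\mathrm{pro}\text{-}\mathcal{C}$ that contains $cC$ and is closed under isomorphisms and under limits in $\mathrm{pro}\text{-}\mathcal{C}$ of diagrams indexed by cofiltered categories. Then $\overline{cC}$ is equal to the class of pro-objects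 essentially of type $C$, that is, those isomorphic in $\mathrm{pro}\text{-}\mathcal{C}$ to a pro-object $Y$ all of whose levels $Y_s$ belong to $C$. -/

import Mathlib

open CategoryTheory CategoryTheory.Limits Opposite

universe v u

/-- A pro-object of a category `𝒞`: a functor to `𝒞` from a small cofiltered (in particular
non-empty) category. Here "small" means that objects and morphisms form types in the universe of
the hom-sets of `𝒞`. -/
structure Pro (𝒞 : Type u) [Category.{v} 𝒞] where
  /-- the index category -/
  Index : Type v
  [category : SmallCategory Index]
  [isCofiltered : IsCofiltered Index]
  /-- the diagram, whose values are the levels of the pro-object -/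
  diagram : Index ⥤ 𝒞

namespace Pro

attribute [instance] Pro.category Pro.isCofiltered

variable {𝒞 : Type u} [Category.{v} 𝒞]

/-- `X.MapsTo Z` is the set `colim_t Hom(X_t, Z)`, for a pro-object `X` and an object `Z`. -/
abbrev MapsTo (X : Pro.{v} 𝒞) (Z : 𝒞) : Type v :=
  (X.diagram.op ⋙ yoneda.obj Z).ColimitType

/-- The element of `colim_t Hom(X_t, Z)` represented by a morphism `X_t ⟶ Z`. -/
def germ (X : Pro.{v} 𝒞) {Z : 𝒞} (t : X.Index) (f : X.diagram.obj t ⟶ Z) : X.MapsTo Z :=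
  (X.diagram.op ⋙ yoneda.obj Z).ιColimitType (op t) f

theorem germ_comp (X : Pro.{v} 𝒞) {Z : 𝒞} {t t' : X.Index} (a : t' ⟶ t)
    (f : X.diagram.obj t ⟶ Z) : X.germ t' (X.diagram.map a ≫ f) = X.germ t f :=
  (X.diagram.op ⋙ yoneda.obj Z).ιColimitType_map a.op f

theorem exists_germ (X : Pro.{v} 𝒞) {Z : 𝒞} (x : X.MapsTo Z) :
    ∃ (t : X.Index) (f : X.diagram.obj t ⟶ Z), X.germ t f = x := by
  obtain ⟨t, f, h⟩ := (X.diagram.op ⋙ yoneda.obj Z).ιColimitType_jointly_surjective x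
  exact ⟨t.unop, f, h⟩

/-- Maps out of `colim_t Hom(X_t, Z)`, given by compatible maps out of the `Hom(X_t, Z)`. -/
def liftGerm (X : Pro.{v} 𝒞) {Z : 𝒞} {T : Type v}
    (φ : ∀ t : X.Index, (X.diagram.obj t ⟶ Z) → T)
    (hφ : ∀ {t t' : X.Index} (a : t' ⟶ t) (f : X.diagram.obj t ⟶ Z),
      φ t' (X.diagram.map a ≫ f) = φ t f) : X.MapsTo Z → T :=
  (X.diagram.op ⋙ yoneda.obj Z).descColimitType
    { pt := T
      ι := fun t f => φ t.unop f
      ι_naturality := fun a => funext fun f => hφ a.unop f }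

theorem liftGerm_germ (X : Pro.{v} 𝒞) {Z : 𝒞} {T : Type v}
    (φ : ∀ t : X.Index, (X.diagram.obj t ⟶ Z) → T)
    (hφ : ∀ {t t' : X.Index} (a : t' ⟶ t) (f : X.diagram.obj t ⟶ Z),
      φ t' (X.diagram.map a ≫ f) = φ t f) (t : X.Index) (f : X.diagram.obj t ⟶ Z) :
    X.liftGerm φ hφ (X.germ t f) = φ t f := rfl

/-- Postcomposition `colim_t Hom(X_t, Z) → colim_t Hom(X_t, Z')` with `g : Z ⟶ Z'`. -/
def postcomp (X : Pro.{v} 𝒞) {Z Z' : 𝒞} (g : Z ⟶ Z') : X.MapsTo Z → X.MapsTo Z' :=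
  X.liftGerm (fun t f => X.germ t (f ≫ g)) (fun a f => by
    rw [Category.assoc, germ_comp])

theorem postcomp_germ (X : Pro.{v} 𝒞) {Z Z' : 𝒞} (g : Z ⟶ Z') (t : X.Index)
    (f : X.diagram.obj t ⟶ Z) : X.postcomp g (X.germ t f) = X.germ t (f ≫ g) := rfl

theorem postcomp_comp (X : Pro.{v} 𝒞) {Z Z' Z'' : 𝒞} (g : Z ⟶ Z') (g' : Z' ⟶ Z'')
    (x : X.MapsTo Z) : X.postcomp g' (X.postcomp g x) = X.postcomp (g ≫ g') x := by
  obtain ⟨t, f, rfl⟩ := X.exists_germ x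
  simp only [postcomp_germ, Category.assoc]

/-- The set `lim_s colim_t Hom(X_t, Y_s)`, as the set of families of elements of
`colim_t Hom(X_t, Y_s)` compatible with the transition maps of `Y`. -/
@[ext]
structure Hom (X Y : Pro.{v} 𝒞) where
  /-- the component in `colim_t Hom(X_t, Y_s)` -/
  app : ∀ s : Y.Index, X.MapsTo (Y.diagram.obj s)
  compat : ∀ {s s' : Y.Index} (b : s' ⟶ s), X.postcomp (Y.diagram.map b) (app s') = app s

/-- The map `colim_s Hom(Y_s, Z) → colim_t Hom(X_t, Z)` induced by a morphism of pro-objects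
`X → Y`. A morphism `g : Y_s ⟶ Z` is sent to the composite of `g` with the component at `s`. -/
def Hom.precomp {X Y : Pro.{v} 𝒞} (f : Hom X Y) {Z : 𝒞} : Y.MapsTo Z → X.MapsTo Z :=
  Y.liftGerm (fun s g => X.postcomp g (f.app s)) (fun b g => by
    rw [← postcomp_comp, f.compat])

theorem Hom.precomp_germ {X Y : Pro.{v} 𝒞} (f : Hom X Y) {Z : 𝒞} (s : Y.Index)
    (g : Y.diagram.obj s ⟶ Z) : f.precomp (Y.germ s g) = X.postcomp g (f.app s) := rfl

theorem Hom.precomp_postcomp {X Y : Pro.{v} 𝒞} (f : Hom X Y) {Z Z' : 𝒞} (h : Z ⟶ Z')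
    (y : Y.MapsTo Z) : f.precomp (Y.postcomp h y) = X.postcomp h (f.precomp y) := by
  obtain ⟨s, g, rfl⟩ := Y.exists_germ y
  rw [postcomp_germ, precomp_germ, precomp_germ, postcomp_comp]

/-- The identity of `X`: its component at `s` is represented by the identity of `X_s`. -/
def Hom.id (X : Pro.{v} 𝒞) : Hom X X where
  app s := X.germ s (𝟙 _)
  compat {s s'} b := by
    rw [postcomp_germ, Category.id_comp, ← X.germ_comp b (𝟙 _), Category.comp_id]

/-- Composition: if the component of `g` at `r` is represented by `Y_s ⟶ Z_r`, and the component
of `f` at `s` is represented by `X_t ⟶ Y_s`, then the component of the composite at `r` is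
represented by `X_t ⟶ Y_s ⟶ Z_r`. -/
def Hom.comp {X Y Z : Pro.{v} 𝒞} (f : Hom X Y) (g : Hom Y Z) : Hom X Z where
  app r := f.precomp (g.app r)
  compat b := by rw [← Hom.precomp_postcomp, g.compat]

/-- The category of pro-objects of `𝒞`. -/
instance : Category.{v} (Pro.{v} 𝒞) where
  Hom := Hom
  id := Hom.id
  comp := Hom.comp
  id_comp {X Y} f := by
    refine Hom.ext (funext fun s => ?_)
    change (Hom.id X).precomp (f.app s) = f.app s
    obtain ⟨t, g, h⟩ := X.exists_germ (f.app s)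
    rw [← h, Hom.precomp_germ]
    change X.germ t (𝟙 _ ≫ g) = _
    rw [Category.id_comp]
  comp_id {X Y} f := by
    refine Hom.ext (funext fun s => ?_)
    change X.postcomp (𝟙 _) (f.app s) = f.app s
    obtain ⟨t, g, h⟩ := X.exists_germ (f.app s)
    rw [← h, postcomp_germ, Category.comp_id]
  assoc {W X Y Z} f g h := by
    refine Hom.ext (funext fun s => ?_)
    change (Hom.comp f g).precomp (h.app s) = f.precomp (g.precomp (h.app s))
    obtain ⟨t, k, hk⟩ := Y.exists_germ (h.app s)
    rw [← hk, Hom.precomp_germ, Hom.precomp_germ, Hom.precomp_postcomp]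
    rfl

/-- The category with one object and one morphism is cofiltered. -/
theorem isCofiltered_discrete_punit : IsCofiltered (Discrete PUnit.{v + 1}) where
  cone_objs X _ := ⟨X, 𝟙 X, eqToHom (Subsingleton.elim _ _), trivial⟩
  cone_maps X _ _ _ := ⟨X, 𝟙 X, Subsingleton.elim _ _⟩
  nonempty := ⟨⟨PUnit.unit⟩⟩

/-- The constant functor `c : 𝒞 ⥤ Pro 𝒞`. It sends an object `X` to the pro-object with value `X`
indexed by the category with one object and one morphism. -/
def const (𝒞 : Type u) [Category.{v} 𝒞] : 𝒞 ⥤ Pro.{v} 𝒞 where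
  obj X :=
    { Index := Discrete PUnit.{v + 1}
      isCofiltered := isCofiltered_discrete_punit
      diagram := Functor.fromPUnit X }
  map f :=
    { app := fun _ => germ _ (Discrete.mk PUnit.unit) f
      compat := fun _ => congrArg (germ _ _) (Category.comp_id f) }
  map_id _ := rfl
  map_comp _ _ := rfl

/-- A pro-object is of type `C` if all of its levels belong to the class `C`. -/
def IsOfType (C : ObjectProperty 𝒞) : ObjectProperty (Pro.{v} 𝒞) :=
  fun X => ∀ s : X.Index, C (X.diagram.obj s)

/-- A pro-object is essentially of type `C` if it is isomorphic, in the category of pro-objects,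
to a pro-object of type `C`. -/
def IsEssentiallyOfType (C : ObjectProperty 𝒞) : ObjectProperty (Pro.{v} 𝒞) :=
  fun X => ∃ Y : Pro.{v} 𝒞, IsOfType C Y ∧ Nonempty (X ≅ Y)

end Pro

/-- The closure of a class `P` of objects of a category `𝒟` under isomorphisms and (small)
cofiltered limits: the smallest class that contains `P` and is closed under isomorphisms and under
all limits in `𝒟` of diagrams indexed by small cofiltered categories. -/
def cofilteredLimitsClosure {𝒟 : Type u} [Category.{v} 𝒟] (P : ObjectProperty 𝒟) :
    ObjectProperty 𝒟 :=
  P.limitsClosure (fun B : {B : Cat.{v, v} // IsCofiltered B} => (B.1 : Type v))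

namespace Pro

variable {𝒞 : Type u} [Category.{v} 𝒞]

/-! Every pro-object is the limit of the constant pro-objects on its levels (`levelConeIsLimit`), so
one essentially of type `C` lies in the closure. Conversely, a cofiltered limit of pro-objects can
be built from the levels of its terms alone. No strict model of the diagram `F` is needed:
`LimitIndex F` has as objects all pairs of a position and an index there, and as morphisms all maps
of levels representing the components of the transition maps. This category is cofiltered, and its
pro-object of levels is the limit of `F` (`cofilteredLimitConeIsLimit`). -/

theorem germ_eq_iff (X : Pro.{v} 𝒞) {Z : 𝒞} {t : X.Index} (f g : X.diagram.obj t ⟶ Z) :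
    X.germ t f = X.germ t g ↔
      ∃ (t' : X.Index) (a : t' ⟶ t), X.diagram.map a ≫ f = X.diagram.map a ≫ g := by
  constructor
  · intro h
    obtain ⟨k, a, hk⟩ := ((X.diagram.op ⋙ yoneda.obj Z).ιColimitType_eq_iff_of_isFiltered' f g).1 h
    exact ⟨k.unop, a.unop, hk⟩
  · rintro ⟨t', a, h⟩
    rw [← X.germ_comp a f, h, X.germ_comp]

theorem postcomp_id (X : Pro.{v} 𝒞) {Z : 𝒞} (x : X.MapsTo Z) : X.postcomp (𝟙 Z) x = x := by
  obtain ⟨t, f, rfl⟩ := X.exists_germ x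
  rw [postcomp_germ, Category.comp_id]

theorem Hom.precomp_germ_id {X Y : Pro.{v} 𝒞} (f : Hom X Y) (s : Y.Index) :
    f.precomp (Y.germ s (𝟙 _)) = f.app s := by
  rw [Hom.precomp_germ, postcomp_id]

@[ext]
theorem hom_ext {X Y : Pro.{v} 𝒞} {f g : X ⟶ Y} (h : ∀ s, Hom.app f s = Hom.app g s) : f = g :=
  Hom.ext (funext h)

theorem id_app (X : Pro.{v} 𝒞) (s : X.Index) : Hom.app (𝟙 X) s = X.germ s (𝟙 _) := rfl

theorem comp_app {X Y Z : Pro.{v} 𝒞} (f : X ⟶ Y) (g : Y ⟶ Z) (r : Z.Index) :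
    Hom.app (f ≫ g) r = Hom.precomp f (Hom.app g r) := rfl

/-! ### A pro-object is the limit of its levels -/

/-- The projection from a pro-object to one of its levels. -/
def toLevel (X : Pro.{v} 𝒞) (s : X.Index) : X ⟶ (const 𝒞).obj (X.diagram.obj s) :=
  show Hom _ _ from
    { app := fun _ => X.germ s (𝟙 _)
      compat := fun _ => postcomp_id X _ }

/-- The cone over the constant pro-objects on the levels of `X`, with vertex `X`. -/
def levelCone (X : Pro.{v} 𝒞) : Cone (X.diagram ⋙ const 𝒞) where
  pt := X
  π :=
    { app := X.toLevel
      naturality := fun s s' b => by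
        refine (Category.id_comp _).trans (hom_ext fun _ => ?_)
        change X.germ s' (𝟙 _) = X.postcomp (X.diagram.map b) (X.germ s (𝟙 _))
        rw [postcomp_germ, Category.id_comp, ← X.germ_comp b (𝟙 _), Category.comp_id] }

/-- A pro-object is the limit of the constant pro-objects on its levels. -/
def levelConeIsLimit (X : Pro.{v} 𝒞) : IsLimit X.levelCone where
  lift c := show Hom _ _ from
    { app := fun s => Hom.app (c.π.app s) (Discrete.mk PUnit.unit)
      compat := fun b => congrArg (fun f => Hom.app f (Discrete.mk PUnit.unit)) (c.w b) }
  fac c s := by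
    refine hom_ext fun _ => ?_
    exact postcomp_id _ _
  uniq c m h := by
    refine hom_ext fun s => ?_
    refine (Hom.precomp_germ_id m s).symm.trans ?_
    exact congrArg (fun f => Hom.app f (Discrete.mk PUnit.unit)) (h s)

/-! ### Cofiltered limits of pro-objects -/

section Limit

variable {J : Type v} [SmallCategory J] (F : J ⥤ Pro.{v} 𝒞)

/-- The index category of the limit of a cofiltered diagram `F` of pro-objects. Its objects are the
pairs of an object `j` of the diagram category and an index of the pro-object `F.obj j`. -/
structure LimitIndex where
  /-- the position in the diagram -/
  base : J
  /-- the index of the pro-object at that position -/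
  idx : (F.obj base).Index

namespace LimitIndex

variable {F}

/-- The level of the pro-object `F.obj k.base` at `k.idx`. -/
abbrev level (k : LimitIndex F) : 𝒞 := (F.obj k.base).diagram.obj k.idx

/-- A morphism of `LimitIndex F` lies over a morphism `a` of the diagram category, and consists of a
morphism between levels which represents the component of `F.map a`. -/
@[ext]
structure Hom (k k' : LimitIndex F) where
  /-- the underlying morphism of the diagram category -/
  base : k.base ⟶ k'.base
  /-- the morphism between levels -/
  map : k.level ⟶ k'.level
  germ_map : (F.obj k.base).germ k.idx map = Pro.Hom.app (F.map base) k'.idx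

theorem germ_comp_eq {k : LimitIndex F} {j j' : J} {a : k.base ⟶ j} {b : j ⟶ j'}
    {s : (F.obj j).Index} {s' : (F.obj j').Index} {f : k.level ⟶ (F.obj j).diagram.obj s}
    {g : (F.obj j).diagram.obj s ⟶ (F.obj j').diagram.obj s'}
    (hf : (F.obj k.base).germ k.idx f = Pro.Hom.app (F.map a) s)
    (hg : (F.obj j).germ s g = Pro.Hom.app (F.map b) s') :
    (F.obj k.base).germ k.idx (f ≫ g) = Pro.Hom.app (F.map (a ≫ b)) s' := by
  rw [F.map_comp, comp_app, ← hg, Pro.Hom.precomp_germ, ← hf, postcomp_germ]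

instance : SmallCategory (LimitIndex F) where
  Hom := Hom
  id k := ⟨𝟙 _, 𝟙 _, by rw [F.map_id, id_app]⟩
  comp f g := ⟨f.base ≫ g.base, f.map ≫ g.map, germ_comp_eq f.germ_map g.germ_map⟩
  id_comp f := Hom.ext (Category.id_comp _) (Category.id_comp _)
  comp_id f := Hom.ext (Category.comp_id _) (Category.comp_id _)
  assoc f g h := Hom.ext (Category.assoc _ _ _) (Category.assoc _ _ _)

/-- The inclusion of the index category of `F.obj j`. -/
def homOfIndex {j : J} {s s' : (F.obj j).Index} (b : s ⟶ s') :
    (⟨j, s⟩ : LimitIndex F) ⟶ ⟨j, s'⟩ :=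
  show Hom _ _ from
    { base := 𝟙 j
      map := (F.obj j).diagram.map b
      germ_map := by
        rw [F.map_id, id_app, ← (F.obj j).germ_comp b (𝟙 _), Category.comp_id] }

/-- Any morphism of the diagram category lifts, after shrinking the index of the source. -/
theorem exists_hom {j : J} (t : (F.obj j).Index) (k : LimitIndex F) (a : j ⟶ k.base) :
    ∃ (t' : (F.obj j).Index) (_ : t' ⟶ t) (f : (⟨j, t'⟩ : LimitIndex F) ⟶ k),
      Hom.base f = a := by
  obtain ⟨s, f, hf⟩ := (F.obj j).exists_germ (Pro.Hom.app (F.map a) k.idx)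
  refine ⟨IsCofiltered.min s t, IsCofiltered.minToRight s t,
    ⟨a, (F.obj j).diagram.map (IsCofiltered.minToLeft s t) ≫ f, ?_⟩, rfl⟩
  rw [germ_comp, hf]

/-- Cones are found in `J` first and then lifted by `exists_hom`; shrinking the index over the
vertex absorbs the choice of representatives. -/
instance [IsCofiltered J] : IsCofiltered (LimitIndex F) where
  nonempty := by
    obtain ⟨j⟩ := IsCofiltered.nonempty (C := J)
    obtain ⟨s⟩ := IsCofiltered.nonempty (C := (F.obj j).Index)
    exact ⟨⟨j, s⟩⟩
  cone_objs k k' := by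
    let j := IsCofiltered.min k.base k'.base
    obtain ⟨t₀⟩ := IsCofiltered.nonempty (C := (F.obj j).Index)
    obtain ⟨t, -, f, -⟩ := exists_hom t₀ k (IsCofiltered.minToLeft _ _)
    -- Lifting the second leg from below `t` lets both legs start at `t'`.
    obtain ⟨t', b, g, -⟩ := exists_hom t k' (IsCofiltered.minToRight _ _)
    exact ⟨⟨j, t'⟩, homOfIndex b ≫ f, g, trivial⟩
  cone_maps k k' f g := by
    obtain ⟨j, a, ha⟩ := IsCofilteredOrEmpty.cone_maps (Hom.base f) (Hom.base g)
    obtain ⟨t₀⟩ := IsCofiltered.nonempty (C := (F.obj j).Index)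
    obtain ⟨t, -, h, rfl⟩ := exists_hom t₀ k a
    -- Both composites represent the same component, since their bases agree by `ha`; hence they
    -- become equal further down the index category.
    have hfg := (germ_comp_eq (Hom.germ_map h) (Hom.germ_map f)).trans
      ((congrArg (fun b => Pro.Hom.app (F.map b) k'.idx) ha).trans
        (germ_comp_eq (Hom.germ_map h) (Hom.germ_map g)).symm)
    obtain ⟨t', b, hb⟩ := (germ_eq_iff _ _ _).1 hfg
    refine ⟨⟨_, t'⟩, homOfIndex b ≫ h, ?_⟩
    rw [Category.assoc, Category.assoc]
    exact Hom.ext (congrArg (𝟙 _ ≫ ·) ha) hb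

end LimitIndex

variable [IsCofiltered J]

/-- The limit of a cofiltered diagram of pro-objects. Its levels are those of the pro-objects of the
diagram. -/
def cofilteredLimit : Pro.{v} 𝒞 where
  Index := LimitIndex F
  diagram :=
    { obj := LimitIndex.level
      map := LimitIndex.Hom.map
      map_id := fun _ => rfl
      map_comp := fun _ _ => rfl }

/-- The projections from `cofilteredLimit F`. -/
def cofilteredLimitπ (j : J) : cofilteredLimit F ⟶ F.obj j :=
  show Hom _ _ from
    { app := fun s => (cofilteredLimit F).germ (⟨j, s⟩ : LimitIndex F) (𝟙 _)
      compat := fun {s s'} b => by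
        refine (postcomp_germ _ _ (⟨j, s'⟩ : LimitIndex F) _).trans (Eq.trans ?_ ((cofilteredLimit F).germ_comp (LimitIndex.homOfIndex b) (𝟙 _)))
        exact congrArg (germ _ _) ((Category.id_comp _).trans (Category.comp_id _).symm) }

/-- The limit cone with vertex `cofilteredLimit F`. -/
def cofilteredLimitCone : Cone F where
  pt := cofilteredLimit F
  π :=
    { app := cofilteredLimitπ F
      naturality := fun j j' a => by
        refine (Category.id_comp _).trans (hom_ext fun s => ?_)
        obtain ⟨t₀⟩ := IsCofiltered.nonempty (C := (F.obj j).Index)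
        obtain ⟨t, -, f, rfl⟩ := LimitIndex.exists_hom t₀ ⟨j', s⟩ a
        -- The lift `f` of `a` is itself a transition map of the limit, so it identifies the two
        -- germs.
        rw [comp_app, ← LimitIndex.Hom.germ_map f, Hom.precomp_germ]
        refine ((cofilteredLimit F).germ_comp f (𝟙 _)).symm.trans ?_
        exact congrArg (germ _ _) ((Category.comp_id _).trans (Category.id_comp _).symm) }

/-- `cofilteredLimitCone F` is a limit cone. -/
def cofilteredLimitConeIsLimit : IsLimit (cofilteredLimitCone F) where
  lift c := show Hom _ _ from
    { app := fun k => Hom.app (c.π.app k.base) k.idx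
      compat := fun {k k'} f => by
        rw [← c.w (LimitIndex.Hom.base f), comp_app, ← LimitIndex.Hom.germ_map f,
          Hom.precomp_germ]
        rfl }
  fac c j := hom_ext fun s => postcomp_id _ _
  -- The projection to `F.obj k.base` has the germ of the identity as its component at `k.idx`, so
  -- composing with it recovers the component of `m` at `k`.
  uniq c m h := hom_ext fun k =>
    (Hom.precomp_germ_id m k).symm.trans
      (congrArg (fun f => Hom.app f k.idx) (h k.base))

end Limit

/-! ### Closure properties of pro-objects essentially of type `C` -/

theorem isEssentiallyOfType_eq_isoClosure (C : ObjectProperty 𝒞) :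
    IsEssentiallyOfType C = (IsOfType C).isoClosure := by
  ext X
  simp only [IsEssentiallyOfType, ObjectProperty.prop_isoClosure_iff, exists_prop]

instance (C : ObjectProperty 𝒞) : (IsEssentiallyOfType C).IsClosedUnderIsomorphisms := by
  rw [isEssentiallyOfType_eq_isoClosure]
  infer_instance

/-- The class of pro-objects essentially of type `C` is closed under cofiltered limits. -/
theorem isClosedUnderLimitsOfShape_isEssentiallyOfType (C : ObjectProperty 𝒞) (J : Type v)
    [SmallCategory J] [IsCofiltered J] :
    (IsEssentiallyOfType C).IsClosedUnderLimitsOfShape J where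
  limitsOfShape_le := by
    -- Replacing the diagram by an isomorphic one makes every term strictly of type `C`.
    rw [isEssentiallyOfType_eq_isoClosure, ObjectProperty.limitsOfShape_isoClosure]
    rintro X ⟨h⟩
    exact ⟨cofilteredLimit h.diag, fun k => h.prop_diag_obj k.base k.idx,
      ⟨h.isLimit.conePointUniqueUpToIso (cofilteredLimitConeIsLimit h.diag)⟩⟩

end Pro

theorem theorem5p1 {𝒞 : Type u} [Category.{v} 𝒞] (C : ObjectProperty 𝒞) :
    cofilteredLimitsClosure (C.strictMap (Pro.const 𝒞)) = Pro.IsEssentiallyOfType C := by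
  apply le_antisymm
  · have (B : {B : Cat.{v, v} // IsCofiltered B}) :
        (Pro.IsEssentiallyOfType C).IsClosedUnderLimitsOfShape (B.1 : Type v) :=
      have := B.2
      Pro.isClosedUnderLimitsOfShape_isEssentiallyOfType C _
    refine ObjectProperty.limitsClosure_le ?_
    rintro _ ⟨X, hX⟩
    exact ⟨_, fun _ => hX, ⟨Iso.refl _⟩⟩
  · rintro X ⟨Y, hY, ⟨e⟩⟩
    refine .of_isoClosure e.symm (.of_limitPresentation
      (a := ⟨Cat.of Y.Index, Y.isCofiltered⟩) ⟨_, _, Y.levelConeIsLimit⟩ fun s => ?_)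
    exact .of_mem _ (C.strictMap_obj _ (hY s))
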